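/- For a positive integer $k$, a $k$-poset is a partially ordered set $P$ together with a labeling $c\colon P\to\{0,\dots,k-1\}$; it is a $k$-lattice if any two elements of $P$ have a supremum and an infimum (the empty poset is allowed). A homomorphism $(P,c)\to(P',c')$ is a map $h\colon P\to P'$ such that $x\le y$ implies $h(x)\le h(y)$, and $c=c'\circ h$. Quasiorder the finite $k$-posets by $(P,c)\le(P',c')$ if and only if there is a homomorphism $(P,c)\to(P',c')$, and let $\tilde{\mathcal P}_k$ be the resulting partially ordered set of classes of homomorphically equivalent finite $k$-posets (where $P$ and $P'$ are homomorphically equivalent if $P\le P'\le P$). Let $\tilde{\mathcal L}_k$ be the partially ordered set obtained in the same way from the finite $k$-lattices. A countable poset $X$ is called universal if every countable poset $Q$ embeds into it, i.e. there is a map $f\colon Q\to X$ with $x\le y\iff f(x)\le f(y)$. **Theorem.** The poset $\tilde{\mathcal P}_k$ is universal for every $k\ge 2$, and the poset $\tilde{\mathcal L}_k$ is universal for every $k\ge 3$. In particular, these posets are countable. -/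

import Mathlib

universe u v

/-- A `k`-poset: a partially ordered set together with a labeling by `{0, …, k - 1}`. -/
structure KPoset (k : ℕ) where
  carrier : Type
  [order : PartialOrder carrier]
  label : carrier → Fin k

namespace KPoset

attribute [instance] KPoset.order

variable {k : ℕ}

/-- A map between `k`-posets is a homomorphism if it preserves the order and the labels. -/
def IsHom (P P' : KPoset k) (h : P.carrier → P'.carrier) : Prop :=
  (∀ x y : P.carrier, x ≤ y → h x ≤ h y) ∧ ∀ x : P.carrier, P'.label (h x) = P.label x

/-- The homomorphism quasiorder: `P ≤ P'` if and only if there is a homomorphism of `P` to `P'`. -/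
instance : Preorder (KPoset k) where
  le P P' := ∃ h : P.carrier → P'.carrier, IsHom P P' h
  le_refl P := ⟨id, fun _ _ hxy => hxy, fun _ => rfl⟩
  le_trans P Q R := by
    rintro ⟨g, hg, hg'⟩ ⟨h, hh, hh'⟩
    exact ⟨h ∘ g, fun x y hxy => hh _ _ (hg x y hxy), fun x => (hh' (g x)).trans (hg' x)⟩

/-- A `k`-poset is a `k`-lattice if any two elements have a supremum and an infimum
(the empty `k`-poset is allowed). -/
def IsKLattice (P : KPoset k) : Prop :=
  ∀ x y : P.carrier, (∃ s, IsLUB {x, y} s) ∧ ∃ i, IsGLB {x, y} i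

end KPoset

/-- The class of finite `k`-posets, with the homomorphism quasiorder. -/
abbrev FinKPoset (k : ℕ) : Type 1 :=
  {P : KPoset k // Finite P.carrier}

/-- The class of finite `k`-lattices, with the homomorphism quasiorder. -/
abbrev FinKLattice (k : ℕ) : Type 1 :=
  {P : KPoset k // Finite P.carrier ∧ P.IsKLattice}

/-- The homomorphism order of finite `k`-posets: the quotient of the homomorphism quasiorder by
homomorphic equivalence, with the induced partial order. -/
abbrev KPosetHomOrder (k : ℕ) : Type 1 :=
  Antisymmetrization (FinKPoset k) (· ≤ ·)

/-- The homomorphism order of finite `k`-lattices: the quotient of the homomorphism quasiorder by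
homomorphic equivalence, with the induced partial order. -/
abbrev KLatticeHomOrder (k : ℕ) : Type 1 :=
  Antisymmetrization (FinKLattice k) (· ≤ ·)

/-- A poset is universal if it is countable and every countable poset embeds into it, that is,
admits an order-preserving and order-reflecting map to it. Here the countable posets of
the universe `u` are embedded. -/
def IsUniversalPoset (X : Type v) [PartialOrder X] : Prop :=
  Countable X ∧
    ∀ (Q : Type u) [PartialOrder Q] [Countable Q], Nonempty (Q ↪o X)

/-!
A finite set `S` with a self-map `σ` and a parity `p : S → ZMod 2` that changes along `σ` gives a
labeled poset, its *crown*: a three-element chain `bot s < mid s < top s` for every `s`, and the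
additional relations `bot (σ s) < top s`; the label of `mid s` is `p s`, that of `bot s` and `top s`
is `p s + 1`. Labels change at every step of a chain, so a homomorphism of crowns takes chains to
chains, and then the additional relations force it to commute with the self-maps. Hence
homomorphisms of crowns amount to parity preserving semiconjugacies (`crown_le_crown_iff`).

Apply this to the disjoint union of the cycles `ZMod (2 * a)`, for `a` in a finite set `A` of
positive integers, with `σ s = s + 1`. A cycle of length `2 * a` maps to one of length `2 * b`
exactly if `b ∣ a`, so the crown of `A` is below that of `B` if and only if every element of `A` has
a divisor in `B` (`cycleCrown_le_iff`). The latter order contains every countable poset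
(`exists_finset_dvd_representation`): enumerate the poset, let the weight of `y` be the product of
the primes indexed by the `z ≥ y` enumerated no later than `y`, and represent `x` by the weights
of the `y ≤ x` enumerated no later than `x`.

For lattices, adjoin a bottom and a top with a third label. This does not change the homomorphism
order (`bounded_le_bounded_iff`), and the result is a lattice because two incomparable elements of
the crown have at most one common lower and at most one common upper bound. Countability holds
since each finite labeled poset is determined up to isomorphism by a labeled relation on some
`Fin n`.
-/

/-! ### Countability -/

namespace KPoset

variable {k : ℕ}

/-- The labeled relation on `Fin n` obtained from a `k`-poset along an enumeration. -/
noncomputable def code (P : KPoset k) {n : ℕ} (e : P.carrier ≃ Fin n) :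
    Σ n : ℕ, (Fin n → Fin n → Bool) × (Fin n → Fin k) :=
  open Classical in
  ⟨n, fun i j => decide (e.symm i ≤ e.symm j), fun i => P.label (e.symm i)⟩

theorem le_of_code_eq {P P' : KPoset k} {n n' : ℕ} (e : P.carrier ≃ Fin n)
    (e' : P'.carrier ≃ Fin n') (h : P.code e = P'.code e') : P ≤ P' := by
  obtain rfl : n = n' := congrArg Sigma.fst h
  have h2 := eq_of_heq (Sigma.mk.inj h).2
  obtain ⟨hr, hl⟩ := Prod.mk.inj h2
  refine ⟨fun x => e'.symm (e x), fun x y hxy => ?_, fun x => ?_⟩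
  · have := congrFun (congrFun hr (e x)) (e y)
    simpa [hxy] using this
  · simpa using (congrFun hl (e x)).symm

end KPoset

/-- A preorder has countably many classes if its elements have codes in a countable type such that
elements with the same code are comparable. -/
theorem countable_antisymmetrization_of_code {α C : Type*} [Preorder α] [Countable C] (f : α → C)
    (hf : ∀ a b, f a = f b → a ≤ b) : Countable (Antisymmetrization α (· ≤ ·)) := by
  refine Function.Injective.countable (f := fun q => f (ofAntisymmetrization (· ≤ ·) q)) ?_
  intro q r h
  have : toAntisymmetrization (· ≤ ·) (ofAntisymmetrization (α := α) (· ≤ ·) q) =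
      toAntisymmetrization (· ≤ ·) (ofAntisymmetrization (· ≤ ·) r) :=
    Quotient.sound ⟨hf _ _ h, hf _ _ h.symm⟩
  simpa using this

theorem countable_kPosetHomOrder_and_kLatticeHomOrder (k : ℕ) :
    Countable (KPosetHomOrder k) ∧ Countable (KLatticeHomOrder k) := by
  have hfin : ∀ P : FinKPoset k, ∃ n, Nonempty (P.1.carrier ≃ Fin n) := fun P =>
    haveI := P.2
    Finite.exists_equiv_fin _
  choose n e using hfin
  constructor
  · exact countable_antisymmetrization_of_code (fun P => P.1.code (e P).some)
      fun P P' h => KPoset.le_of_code_eq _ _ h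
  · exact countable_antisymmetrization_of_code
      (fun P : FinKLattice k => P.1.code (e ⟨P.1, P.2.1⟩).some)
      fun P P' h => KPoset.le_of_code_eq _ _ h

/-! ### Representing countable posets by divisibility -/

/-- Every countable poset is represented by finite sets of integers `≥ 2`, ordered by
`A ≤ B` if and only if every element of `A` has a divisor in `B`. -/
theorem exists_finset_dvd_representation (Q : Type*) [PartialOrder Q] [Countable Q] :
    ∃ F : Q → Finset ℕ, (∀ x, ∀ a ∈ F x, 2 ≤ a) ∧
      ∀ x y, x ≤ y ↔ ∀ a ∈ F x, ∃ b ∈ F y, b ∣ a := by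
  classical
  obtain ⟨e, he⟩ := Countable.exists_injective_nat Q
  have hfin : ∀ (r : Q → Prop) (x : Q), {y | r y ∧ e y ≤ e x}.Finite := fun r x =>
    ((Set.finite_Iic (e x)).preimage he.injOn).subset fun _ hy => hy.2
  let up : Q → Finset Q := fun y => (hfin (y ≤ ·) y).toFinset
  let down : Q → Finset Q := fun x => (hfin (· ≤ x) x).toFinset
  have mem_up : ∀ y z, z ∈ up y ↔ y ≤ z ∧ e z ≤ e y := fun y z => by simp [up]
  have mem_down : ∀ x y, y ∈ down x ↔ y ≤ x ∧ e y ≤ e x := fun x y => by simp [down]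
  let q : Q → ℕ := fun z => Nat.nth Nat.Prime (e z)
  have hq : ∀ z, (q z).Prime := fun z => Nat.prime_nth_prime _
  have q_inj : Function.Injective q := fun x y h =>
    he (Nat.nth_injective Nat.infinite_setOfPred_prime h)
  let w : Q → ℕ := fun y => ∏ z ∈ up y, q z
  have hw : ∀ y z, q z ∣ w y ↔ z ∈ up y := by
    intro y z
    refine ⟨fun h => ?_, fun h => Finset.dvd_prod_of_mem _ h⟩
    obtain ⟨z', hz', hd⟩ := (hq z).prime.exists_mem_finset_dvd h
    rwa [q_inj ((Nat.prime_dvd_prime_iff_eq (hq z) (hq z')).1 hd)]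
  have hpos : ∀ y, 0 < w y := fun y => Finset.prod_pos fun z _ => (hq z).pos
  have self_up : ∀ y, y ∈ up y := fun y => (mem_up y y).2 ⟨le_rfl, le_rfl⟩
  refine ⟨fun x => (down x).image w, fun x a ha => ?_, fun x y => ⟨fun hxy a ha => ?_, fun h => ?_⟩⟩
  · obtain ⟨y, -, rfl⟩ := Finset.mem_image.1 ha
    exact (hq y).two_le.trans (Nat.le_of_dvd (hpos y) ((hw y y).2 (self_up y)))
  · obtain ⟨z, hz, rfl⟩ := Finset.mem_image.1 ha
    have hz := (mem_down x z).1 hz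
    -- `z` itself serves if it is enumerated before `y`; otherwise `y` does.
    rcases le_total (e z) (e y) with h | h
    · exact ⟨w z, Finset.mem_image_of_mem _ ((mem_down y z).2 ⟨hz.1.trans hxy, h⟩), dvd_rfl⟩
    · refine ⟨w y, Finset.mem_image_of_mem _ ((mem_down y y).2 ⟨le_rfl, le_rfl⟩),
        Finset.prod_dvd_prod_of_subset _ _ _ fun v hv => ?_⟩
      have hv := (mem_up y v).1 hv
      exact (mem_up z v).2 ⟨(hz.1.trans hxy).trans hv.1, hv.2.trans h⟩
  · obtain ⟨b, hb, hd⟩ := h (w x) (Finset.mem_image_of_mem _ ((mem_down x x).2 ⟨le_rfl, le_rfl⟩))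
    obtain ⟨z, hz, rfl⟩ := Finset.mem_image.1 hb
    have := (hw x z).1 (((hw z z).2 (self_up z)).trans hd)
    exact ((mem_up x z).1 this).1.trans ((mem_down y z).1 hz).1

/-! ### Crowns -/

/-- The underlying set of the crown of a self-map `σ` of `S`: three levels, each a copy of `S`. -/
inductive Crown {S : Type} (σ : S → S) : Type
  | bot (s : S)
  | mid (s : S)
  | top (s : S)

namespace Crown

variable {S T : Type} {σ : S → S} {τ : T → T}

/-- The order of the crown: chains `bot s < mid s < top s`, and `bot (σ s) < top s`. -/
def le : Crown σ → Crown σ → Prop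
  | bot s, bot t => s = t
  | bot s, mid t => s = t
  | bot s, top t => s = t ∨ s = σ t
  | mid s, mid t => s = t
  | mid s, top t => s = t
  | top s, top t => s = t
  | _, _ => False

instance : PartialOrder (Crown σ) where
  le := le
  le_refl x := by cases x <;> simp [le]
  le_trans x y z := by
    cases x <;> cases y <;> cases z <;> simp only [le] <;> grind
  le_antisymm x y := by
    cases x <;> cases y <;> simp +contextual [le]

theorem le_def (x y : Crown σ) : x ≤ y ↔ le x y := Iff.rfl

instance [Finite S] : Finite (Crown σ) := by
  refine Finite.of_surjective
    (Sum.elim bot (Sum.elim mid top) : S ⊕ (S ⊕ S) → Crown σ) ?_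
  rintro (s | s | s)
  · exact ⟨Sum.inl s, rfl⟩
  · exact ⟨Sum.inr (Sum.inl s), rfl⟩
  · exact ⟨Sum.inr (Sum.inr s), rfl⟩

/-- The parity of the elements of a crown, from which the labels are read off. -/
def parity (σ : S → S) (p : S → ZMod 2) : Crown σ → ZMod 2
  | bot s => p s + 1
  | mid s => p s
  | top s => p s + 1

/-- The map of crowns induced by a map of the index sets. -/
def map (f : S → T) : Crown σ → Crown τ
  | bot s => bot (f s)
  | mid s => mid (f s)
  | top s => top (f s)

/-- Two distinct common lower bounds of a pair of incomparable elements could only be `bot s` and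
`bot (σ s)`, below `top s` and `top (σ s)`, with `σ (σ s) = s`. -/
theorem eq_of_common_lowerBounds (hσ : σ.Injective) (h2 : ∀ s, σ (σ s) ≠ s) {x y a b : Crown σ}
    (hxy : ¬x ≤ y) (hyx : ¬y ≤ x) (hax : a ≤ x) (hay : a ≤ y) (hbx : b ≤ x) (hby : b ≤ y) :
    a = b := by
  have hσ' : ∀ s t, σ s = σ t → s = t := fun _ _ h => hσ h
  simp only [le_def] at *
  cases x <;> cases y <;> cases a <;> cases b <;> simp only [le] at * <;> grind

theorem eq_of_common_upperBounds (hσ : σ.Injective) (h2 : ∀ s, σ (σ s) ≠ s) {x y a b : Crown σ}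
    (hxy : ¬x ≤ y) (hyx : ¬y ≤ x) (hxa : x ≤ a) (hya : y ≤ a) (hxb : x ≤ b) (hyb : y ≤ b) :
    a = b := by
  have hσ' : ∀ s t, σ s = σ t → s = t := fun _ _ h => hσ h
  simp only [le_def] at *
  cases x <;> cases y <;> cases a <;> cases b <;> simp only [le] at * <;> grind

end Crown

namespace KPoset

variable {k : ℕ}

/-- The crown as a `k`-poset, labeled by parity; `ZMod 2` is `Fin 2` by definition, which is
included in `Fin k`. -/
def crown (hk : 2 ≤ k) {S : Type} (σ : S → S) (p : S → ZMod 2) : KPoset k where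
  carrier := Crown σ
  label x := Fin.castLE hk (Crown.parity σ p x)

theorem crown_le_crown_iff (hk : 2 ≤ k) {S T : Type} {σ : S → S} {τ : T → T} {p : S → ZMod 2}
    {q : T → ZMod 2} (hp : ∀ s, p (σ s) = p s + 1) :
    crown hk σ p ≤ crown hk τ q ↔
      ∃ f : S → T, Function.Semiconj f σ τ ∧ ∀ s, q (f s) = p s := by
  have hne : ∀ a : ZMod 2, a + 1 ≠ a := by decide
  constructor
  · rintro ⟨h, hle, hlab⟩
    replace hlab : ∀ x, Crown.parity τ q (h x) = Crown.parity σ p x := fun x =>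
      Fin.castLE_injective hk (hlab x)
    change Crown σ → Crown τ at h
    replace hle : ∀ x y : Crown σ, x ≤ y → h x ≤ h y := hle
    -- Both steps of a chain change the label, so they are strict in the image, which is a chain.
    have key : ∀ s, ∃ t, h (.mid s) = .mid t ∧ h (.bot s) = .bot t ∧ h (.top s) = .top t := by
      intro s
      have h1 : (h (.bot s)).le (h (.mid s)) := hle (.bot s) (.mid s) rfl
      have h2 : (h (.mid s)).le (h (.top s)) := hle (.mid s) (.top s) rfl
      have l0 := hlab (.bot s)
      have l1 := hlab (.mid s)
      have l2 := hlab (.top s)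
      have := hne (p s)
      cases hb : h (.bot s) <;> cases hm : h (.mid s) <;> cases ht : h (.top s) <;>
        simp only [hb, hm, ht, Crown.le, Crown.parity] at h1 h2 l0 l1 l2 <;> grind
    choose f hm hb ht using key
    have hq : ∀ s, q (f s) = p s := fun s => by
      have := hlab (.mid s)
      rwa [hm] at this
    refine ⟨f, fun s => ?_, hq⟩
    have h1 := hle (.bot (σ s)) (.top s) (Or.inr rfl)
    rw [hb, ht] at h1
    -- The parities of `f (σ s)` and `f s` differ.
    refine Or.resolve_left h1 fun heq => hne (p s) ?_
    rw [← hp, ← hq, heq, hq]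
  · rintro ⟨f, hf, hq⟩
    have hpar : ∀ x : Crown σ, Crown.parity τ q (Crown.map f x) = Crown.parity σ p x := by
      intro x
      cases x <;> simp only [Crown.map, Crown.parity, hq]
    refine ⟨Crown.map f, fun x y hxy => ?_, fun x => congrArg (Fin.castLE hk) (hpar x)⟩
    change Crown.le x y at hxy
    change Crown.le (Crown.map f x) (Crown.map f y)
    cases x <;> cases y <;> simp only [Crown.le, Crown.map] at hxy ⊢ <;>
      first
        | exact congrArg f hxy
        | exact hxy.imp (congrArg f) fun h => (congrArg f h).trans (hf _)

end KPoset

/-! ### Crowns of disjoint unions of cycles -/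

/-- The disjoint union of the cycles of length `2 * a`, for `a ∈ A`. -/
abbrev Cycles (A : Finset ℕ) : Type := Σ a : A, ZMod (2 * a.1)

/-- One step along the cycle. -/
def Cycles.step {A : Finset ℕ} (s : Cycles A) : Cycles A := ⟨s.1, s.2 + 1⟩

/-- The residue modulo `2` of the position on the cycle. -/
def Cycles.parity {A : Finset ℕ} (s : Cycles A) : ZMod 2 :=
  ZMod.castHom (Dvd.intro _ rfl) (ZMod 2) s.2

theorem Cycles.step_injective {A : Finset ℕ} : (step (A := A)).Injective := by
  rintro ⟨a, i⟩ ⟨b, j⟩ h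
  obtain rfl : a = b := congrArg Sigma.fst h
  simpa [step] using h

theorem Cycles.parity_step {A : Finset ℕ} (s : Cycles A) : s.step.parity = s.parity + 1 := by
  obtain ⟨a, i⟩ := s
  exact (map_add (ZMod.castHom (Dvd.intro _ rfl) (ZMod 2)) i 1).trans (by rw [map_one]; rfl)

theorem Cycles.iterate_step {A : Finset ℕ} (s : Cycles A) (n : ℕ) :
    step^[n] s = ⟨s.1, s.2 + n⟩ := by
  obtain ⟨a, i⟩ := s
  induction n with
  | zero => simp
  | succ n ih =>
    rw [Function.iterate_succ_apply', ih]
    simp [step, add_assoc]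

theorem Cycles.iterate_step_eq_iff {A : Finset ℕ} (s : Cycles A) (n : ℕ) :
    step^[n] s = s ↔ 2 * s.1.1 ∣ n := by
  rw [iterate_step, ← ZMod.natCast_eq_zero_iff]
  obtain ⟨a, i⟩ := s
  simp

theorem Cycles.finite {A : Finset ℕ} (hA : ∀ a ∈ A, 2 ≤ a) : Finite (Cycles A) := by
  have : ∀ a : A, Finite (ZMod (2 * a.1)) := fun a => by
    have := hA a.1 a.2
    have : NeZero (2 * a.1) := ⟨by omega⟩
    infer_instance
  infer_instance

namespace KPoset

variable {k : ℕ}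

/-- The crown of the disjoint union of the cycles of length `2 * a`, for `a ∈ A`. -/
def cycleCrown (hk : 2 ≤ k) (A : Finset ℕ) : KPoset k :=
  crown hk (Cycles.step (A := A)) Cycles.parity

theorem cycleCrown_le_iff (hk : 2 ≤ k) (A B : Finset ℕ) :
    cycleCrown hk A ≤ cycleCrown hk B ↔ ∀ a ∈ A, ∃ b ∈ B, b ∣ a := by
  rw [cycleCrown, cycleCrown, crown_le_crown_iff hk Cycles.parity_step]
  constructor
  · rintro ⟨f, hf, -⟩ a ha
    let s : Cycles A := ⟨⟨a, ha⟩, 0⟩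
    have h1 : Cycles.step^[2 * a] s = s := (Cycles.iterate_step_eq_iff s _).2 dvd_rfl
    have h2 := (hf.iterate_right (2 * a)).eq s
    rw [h1] at h2
    exact ⟨(f s).1.1, (f s).1.2,
      Nat.dvd_of_mul_dvd_mul_left two_pos ((Cycles.iterate_step_eq_iff _ _).1 h2.symm)⟩
  · intro h
    choose g hg hd using h
    refine ⟨fun s => ⟨⟨g s.1 s.1.2, hg _ _⟩,
      ZMod.castHom (Nat.mul_dvd_mul_left 2 (hd s.1 s.1.2)) _ s.2⟩, fun s => ?_, fun s => ?_⟩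
    · obtain ⟨a, i⟩ := s
      exact congrArg (Sigma.mk _) ((map_add (ZMod.castHom _ _) i 1).trans (by rw [map_one]; rfl))
    · simp only [Cycles.parity]
      rw [← RingHom.comp_apply]
      -- There is at most one ring homomorphism from `ZMod (2 * a)` to `ZMod 2`.
      exact congrArg (fun φ : ZMod (2 * s.1.1) →+* ZMod 2 => φ s.2) (Subsingleton.elim _ _)

end KPoset

/-! ### Adjoining bounds -/

/-- If any two incomparable elements have at most one common upper and at most one common lower bound,
then adjoining a bottom and a top gives a lattice. -/
theorem exists_isLUB_and_exists_isGLB_withBot_withTop {α : Type*} [PartialOrder α]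
    (hlow : ∀ x y a b : α, ¬x ≤ y → ¬y ≤ x → a ≤ x → a ≤ y → b ≤ x → b ≤ y → a = b)
    (hup : ∀ x y a b : α, ¬x ≤ y → ¬y ≤ x → x ≤ a → y ≤ a → x ≤ b → y ≤ b → a = b)
    (x y : WithBot (WithTop α)) : (∃ s, IsLUB {x, y} s) ∧ ∃ i, IsGLB {x, y} i := by
  have comparable : ∀ x y : WithBot (WithTop α), x ≤ y →
      (∃ s, IsLUB {x, y} s) ∧ ∃ i, IsGLB {x, y} i := fun x y h =>
    ⟨⟨y, by simp [IsLUB, IsLeast, lowerBounds, h]⟩,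
      ⟨x, by simp +contextual [IsGLB, IsGreatest, upperBounds, h]⟩⟩
  by_cases hxy : x ≤ y
  · exact comparable x y hxy
  by_cases hyx : y ≤ x
  · have := comparable y x hyx
    rwa [Set.pair_comm] at this
  induction x with
  | bot => exact absurd bot_le hxy
  | coe x =>
  induction y with
  | bot => exact absurd bot_le hyx
  | coe y =>
  induction x with
  | top => exact absurd (WithBot.coe_le_coe.2 le_top) hyx
  | coe x =>
  induction y with
  | top => exact absurd (WithBot.coe_le_coe.2 le_top) hxy
  | coe y =>
  simp only [WithBot.coe_le_coe, WithTop.coe_le_coe] at hxy hyx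
  constructor
  · by_cases h : ∃ a, x ≤ a ∧ y ≤ a
    · obtain ⟨a, hxa, hya⟩ := h
      refine ⟨((a : WithTop α) : WithBot (WithTop α)), ?_, ?_⟩
      · rintro z (rfl | rfl)
        · exact WithBot.coe_le_coe.2 (WithTop.coe_le_coe.2 hxa)
        · exact WithBot.coe_le_coe.2 (WithTop.coe_le_coe.2 hya)
      · intro z hz
        have hxz := hz (Set.mem_insert _ _)
        have hyz := hz (Set.mem_insert_of_mem _ rfl)
        induction z with
        | bot => exact absurd (le_bot_iff.1 hxz) WithBot.coe_ne_bot
        | coe z =>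
        induction z with
        | top => exact WithBot.coe_le_coe.2 le_top
        | coe b =>
          rw [hup x y a b hxy hyx hxa hya
            (WithTop.coe_le_coe.1 (WithBot.coe_le_coe.1 hxz))
            (WithTop.coe_le_coe.1 (WithBot.coe_le_coe.1 hyz))]
    · refine ⟨((⊤ : WithTop α) : WithBot (WithTop α)), ?_, ?_⟩
      · rintro z (rfl | rfl) <;> exact WithBot.coe_le_coe.2 le_top
      · intro z hz
        have hxz := hz (Set.mem_insert _ _)
        have hyz := hz (Set.mem_insert_of_mem _ rfl)
        induction z with
        | bot => exact absurd (le_bot_iff.1 hxz) WithBot.coe_ne_bot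
        | coe z =>
        induction z with
        | top => exact le_rfl
        | coe b =>
          exact absurd ⟨b, WithTop.coe_le_coe.1 (WithBot.coe_le_coe.1 hxz),
            WithTop.coe_le_coe.1 (WithBot.coe_le_coe.1 hyz)⟩ h
  · by_cases h : ∃ a, a ≤ x ∧ a ≤ y
    · obtain ⟨a, hax, hay⟩ := h
      refine ⟨((a : WithTop α) : WithBot (WithTop α)), ?_, ?_⟩
      · rintro z (rfl | rfl)
        · exact WithBot.coe_le_coe.2 (WithTop.coe_le_coe.2 hax)
        · exact WithBot.coe_le_coe.2 (WithTop.coe_le_coe.2 hay)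
      · intro z hz
        have hzx := hz (Set.mem_insert _ _)
        have hzy := hz (Set.mem_insert_of_mem _ rfl)
        induction z with
        | bot => exact bot_le
        | coe z =>
        induction z with
        | top => exact absurd (top_le_iff.1 (WithBot.coe_le_coe.1 hzx)) WithTop.coe_ne_top
        | coe b =>
          rw [hlow x y a b hxy hyx hax hay
            (WithTop.coe_le_coe.1 (WithBot.coe_le_coe.1 hzx))
            (WithTop.coe_le_coe.1 (WithBot.coe_le_coe.1 hzy))]
    · refine ⟨(⊥ : WithBot (WithTop α)), ?_, ?_⟩
      · exact fun z _ => bot_le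
      · intro z hz
        have hzx := hz (Set.mem_insert _ _)
        have hzy := hz (Set.mem_insert_of_mem _ rfl)
        induction z with
        | bot => exact le_rfl
        | coe z =>
        induction z with
        | top => exact absurd (top_le_iff.1 (WithBot.coe_le_coe.1 hzx)) WithTop.coe_ne_top
        | coe b =>
          exact absurd ⟨b, WithTop.coe_le_coe.1 (WithBot.coe_le_coe.1 hzx),
            WithTop.coe_le_coe.1 (WithBot.coe_le_coe.1 hzy)⟩ h

namespace KPoset

variable {k : ℕ}

/-- The `k`-poset obtained by adjoining a bottom and a top, both with label `c`. -/
def bounded (P : KPoset k) (c : Fin k) : KPoset k where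
  carrier := WithBot (WithTop P.carrier)
  label x := x.recBotCoe c fun y => y.recTopCoe c P.label

/-- If `c` is not a label of `P`, then a homomorphism between the bounded posets takes `P` to
`P'`, since the bounds of the target have label `c`. -/
theorem bounded_le_bounded_iff {P P' : KPoset k} {c : Fin k} (hP : ∀ x, P.label x ≠ c) :
    P.bounded c ≤ P'.bounded c ↔ P ≤ P' := by
  constructor
  · rintro ⟨h, hle, hlab⟩
    have key : ∀ x : P.carrier, ∃ y : P'.carrier,
        h ((x : WithTop P.carrier) : WithBot (WithTop P.carrier)) =
          ((y : WithTop P'.carrier) : WithBot (WithTop P'.carrier)) := by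
      intro x
      have hx := hlab ((x : WithTop P.carrier) : WithBot (WithTop P.carrier))
      generalize h ((x : WithTop P.carrier) : WithBot (WithTop P.carrier)) = z at hx
      change WithBot (WithTop P'.carrier) at z
      induction z with
      | bot => exact absurd (Eq.symm hx) (hP x)
      | coe z =>
        induction z with
        | top => exact absurd (Eq.symm hx) (hP x)
        | coe y => exact ⟨y, rfl⟩
    choose g hg using key
    refine ⟨g, fun x y hxy => ?_, fun x => ?_⟩
    · have := hle _ _ (WithBot.coe_le_coe.2 (WithTop.coe_le_coe.2 hxy))
      rw [hg, hg] at this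
      exact WithTop.coe_le_coe.1 (WithBot.coe_le_coe.1 this)
    · have := hlab ((x : WithTop P.carrier) : WithBot (WithTop P.carrier))
      rw [hg] at this
      exact this
  · rintro ⟨h, hle, hlab⟩
    have hmono : Monotone h := fun x y => hle x y
    refine ⟨WithBot.map (WithTop.map h), fun x y hxy => hmono.withTop_map.withBot_map hxy, ?_⟩
    intro x
    change WithBot (WithTop P.carrier) at x
    induction x with
    | bot => rfl
    | coe x =>
      induction x with
      | top => rfl
      | coe x => exact hlab x

theorem finite_cycleCrown (hk : 2 ≤ k) {A : Finset ℕ} (hA : ∀ a ∈ A, 2 ≤ a) :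
    Finite (cycleCrown hk A).carrier := by
  have := Cycles.finite hA
  exact inferInstanceAs (Finite (Crown (Cycles.step (A := A))))

theorem isKLattice_bounded_cycleCrown (hk : 2 ≤ k) {A : Finset ℕ} (hA : ∀ a ∈ A, 2 ≤ a)
    (c : Fin k) : ((cycleCrown hk A).bounded c).IsKLattice := by
  -- A fixed point of the second iterate would lie on a cycle of length `2 * 1`.
  have h2 : ∀ s : Cycles A, s.step.step ≠ s := by
    intro s hs
    have hd := (Cycles.iterate_step_eq_iff s 2).1 hs
    have := Nat.le_of_dvd two_pos hd
    have := hA s.1.1 s.1.2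
    omega
  exact exists_isLUB_and_exists_isGLB_withBot_withTop
    (fun _ _ _ _ => Crown.eq_of_common_lowerBounds Cycles.step_injective h2)
    (fun _ _ _ _ => Crown.eq_of_common_upperBounds Cycles.step_injective h2)

end KPoset

/-! ### Universality -/

/-- A preorder with countably many classes is universal up to equivalence as soon as it contains
the finite sets of integers `≥ 2`, ordered by `A ≤ B` if and only if every element of `A` has a
divisor in `B`. -/
theorem isUniversalPoset_antisymmetrization {α : Type v} [Preorder α]
    (hc : Countable (Antisymmetrization α (· ≤ ·)))
    (G : {A : Finset ℕ // ∀ a ∈ A, 2 ≤ a} → α)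
    (hG : ∀ A B, G A ≤ G B ↔ ∀ a ∈ A.1, ∃ b ∈ B.1, b ∣ a) :
    IsUniversalPoset.{u} (Antisymmetrization α (· ≤ ·)) := by
  refine ⟨hc, fun Q _ _ => ?_⟩
  obtain ⟨F, hF, hle⟩ := exists_finset_dvd_representation Q
  refine ⟨OrderEmbedding.ofMapLEIff
    (fun x => toAntisymmetrization (· ≤ ·) (G ⟨F x, hF x⟩)) fun x y => ?_⟩
  rw [toAntisymmetrization_le_toAntisymmetrization_iff, hG, hle]

theorem mainTheorem1 :
    (∀ k : ℕ, 2 ≤ k → IsUniversalPoset.{u, 1} (KPosetHomOrder k)) ∧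
      (∀ k : ℕ, 3 ≤ k → IsUniversalPoset.{u, 1} (KLatticeHomOrder k)) := by
  constructor
  · intro k hk
    exact isUniversalPoset_antisymmetrization (countable_kPosetHomOrder_and_kLatticeHomOrder k).1
      (fun A => ⟨KPoset.cycleCrown hk A.1, KPoset.finite_cycleCrown hk A.2⟩)
      fun A B => KPoset.cycleCrown_le_iff hk A.1 B.1
  · intro k hk
    have hk2 : 2 ≤ k := by omega
    let c : Fin k := ⟨2, hk⟩
    have hlab : ∀ (A : Finset ℕ) (x : (KPoset.cycleCrown hk2 A).carrier),
        (KPoset.cycleCrown hk2 A).label x ≠ c := fun A x h =>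
      absurd (congrArg Fin.val h) (Crown.parity Cycles.step Cycles.parity x).isLt.ne
    refine isUniversalPoset_antisymmetrization (countable_kPosetHomOrder_and_kLatticeHomOrder k).2
      (fun A => ⟨(KPoset.cycleCrown hk2 A.1).bounded c, ?_,
        KPoset.isKLattice_bounded_cycleCrown hk2 A.2 c⟩)
      fun A B => (KPoset.bounded_le_bounded_iff (hlab A.1)).trans
        (KPoset.cycleCrown_le_iff hk2 A.1 B.1)
    have := KPoset.finite_cycleCrown hk2 A.2
    exact inferInstanceAs (Finite (WithBot (WithTop (KPoset.cycleCrown hk2 A.1).carrier)))
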